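/- Let $m\ge 1$ be an integer. For $\beta>1$ and $x\in\mathbb R$ let $$\Sigma_{\beta,m}(x)=\Big\{(\epsilon_i)_{i\ge 1}\in\{0,\ldots,m\}^{\mathbb N}:\ \sum_{i=1}^\infty \epsilon_i\beta^{-i}=x\Big\}$$ be the set of $\beta$-expansions of $x$, and let $\mathcal N_{\beta,m,n}(x)$ be the number of words $(\epsilon_1,\ldots,\epsilon_n)\in\{0,\ldots,m\}^n$ that are the first $n$ digits of some element of $\Sigma_{\beta,m}(x)$ (the $n$-prefixes of $x$). Equip $\{0,\ldots,m\}^{\mathbb N}$ with the metric $d(\epsilon,\delta)=(m+1)^{-n(\epsilon,\delta)}$ for $\epsilon\ne\delta$, where $n(\epsilon,\delta)=\min\{i\ge 1:\epsilon_i\ne\delta_i\}$, and $d(\epsilon,\epsilon)=0$. Put $$\mathcal G(m)=\begin{cases}k+1 & \text{if } m=2k,\\[2pt] \dfrac{k+1+\sqrt{k^2+6k+5}}{2} & \text{if } m=2k+1.\end{cases}$$ **Theorem.** (a) For every $m\ge 1$, $\mathcal G(m)$ is a generalised golden ratio for $m$: for every $\beta\in(1,\mathcal G(m))$ and every $x\in(0,\frac{m}{\beta-1})$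 the set $\Sigma_{\beta,m}(x)$ is uncountable, and for every $\beta\in(\mathcal G(m),m+1]$ there is $x\in(0,\frac{m}{\beta-1})$ such that $\Sigma_{\beta,m}(x)$ has exactly one element. (b) For every $\beta>1$ there is a constant $c=c(\beta)>0$, depending only on $\beta$, such that for every $m\ge 1$ with $\beta<\mathcal G(m)$ and every $x\in(0,\frac{m}{\beta-1})$ $$\dim_H \Sigma_{\beta,m}(x)\ \ge\ c,\qquad \liminf_{n\to\infty}\frac{\log_{m+1}\mathcal N_{\beta,m,n}(x)}{n}\ \ge\ c,\qquad \limsup_{n\to\infty}\frac{\log_{m+1}\mathcal N_{\beta,m,n}(x)}{n}\ \ge\ c,$$ where $\dim_H$ is the Hausdorff dimension with respect to $d$. -/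

import Mathlib

/-- The space `{0, …, m}^ℕ` of digit sequences. The entry at index `i : ℕ` is the digit
`ε_{i+1}` of the usual numbering `(ε_1, ε_2, …)`. It is a type synonym, so that it carries the
metric below and no other one. -/
def DigitSeq (m : ℕ) : Type := ℕ → Fin (m + 1)

/-- The distance `(m+1)^{-n(x,y)}`, with `n(x,y) ≥ 1` the first place (counted from one) at which
`x` and `y` differ; `PiNat.firstDiff` counts places from zero. -/
noncomputable def digitDist (m : ℕ) (x y : ℕ → Fin (m + 1)) : ℝ :=
  open Classical in
  if x = y then 0 else (((m : ℝ) + 1) ^ (PiNat.firstDiff x y + 1))⁻¹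

theorem digitDist_nonneg (m : ℕ) (x y : ℕ → Fin (m + 1)) : 0 ≤ digitDist m x y := by
  unfold digitDist
  split_ifs
  · exact le_rfl
  · positivity

theorem digitDist_triangle (m : ℕ) (x y z : ℕ → Fin (m + 1)) :
    digitDist m x z ≤ digitDist m x y + digitDist m y z := by
  have h1 := digitDist_nonneg m x y
  have h2 := digitDist_nonneg m y z
  by_cases hxz : x = z
  · have : digitDist m x z = 0 := by simp [digitDist, hxz]
    linarith
  by_cases hxy : x = y
  · subst hxy; linarith
  by_cases hyz : y = z
  · subst hyz; linarith
  have hb : (1 : ℝ) ≤ (m : ℝ) + 1 := by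
    have : (0 : ℝ) ≤ m := Nat.cast_nonneg m
    linarith
  have key : ∀ a b : ℕ, a ≤ b →
      (((m : ℝ) + 1) ^ (b + 1))⁻¹ ≤ (((m : ℝ) + 1) ^ (a + 1))⁻¹ := by
    intro a b hab
    apply inv_anti₀ (by positivity)
    exact pow_le_pow_right₀ hb (by omega)
  have h3 := PiNat.min_firstDiff_le x y z hxz
  rcases min_le_iff.mp h3 with h | h
  · have := key _ _ h
    simp only [digitDist, hxz, hxy, hyz, if_false] at *
    linarith
  · have := key _ _ h
    simp only [digitDist, hxz, hxy, hyz, if_false] at *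
    linarith

theorem digitDist_self (m : ℕ) (x : ℕ → Fin (m + 1)) : digitDist m x x = 0 := by
  simp [digitDist]

theorem digitDist_comm (m : ℕ) (x y : ℕ → Fin (m + 1)) :
    digitDist m x y = digitDist m y x := by
  by_cases h : x = y
  · subst h; rfl
  · have h' : ¬ y = x := fun e => h e.symm
    simp only [digitDist, PiNat.firstDiff_comm x y, h, h', if_false]

theorem eq_of_digitDist_eq_zero (m : ℕ) (x y : ℕ → Fin (m + 1)) (h : digitDist m x y = 0) :
    x = y := by
  by_contra hne
  simp only [digitDist, hne, if_false] at h
  have : (0 : ℝ) < (((m : ℝ) + 1) ^ (PiNat.firstDiff x y + 1))⁻¹ := by positivity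
  linarith

noncomputable instance instMetricSpaceDigitSeq (m : ℕ) : MetricSpace (DigitSeq m) where
  dist x y := digitDist m x y
  dist_self x := digitDist_self m x
  dist_comm x y := digitDist_comm m x y
  dist_triangle x y z := digitDist_triangle m x y z
  eq_of_dist_eq_zero {x y} h := eq_of_digitDist_eq_zero m x y h

/-- The set `Σ_{β,m}(x)` of `β`-expansions of `x`: the sequences `(ε_i)_{i ≥ 1}` in `{0, …, m}^ℕ`
with `∑_{i ≥ 1} ε_i β^{-i} = x`. -/
def betaExpansions (β : ℝ) (m : ℕ) (x : ℝ) : Set (DigitSeq m) :=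
  {ε | HasSum (fun i : ℕ => ((ε i : ℕ) : ℝ) / β ^ (i + 1)) x}

/-- The set of `n`-prefixes of `x`: the words of length `n` that extend to a `β`-expansion. -/
def betaPrefixes (β : ℝ) (m n : ℕ) (x : ℝ) : Set (Fin n → Fin (m + 1)) :=
  {p | ∃ ε ∈ betaExpansions β m x, ∀ i : Fin n, ε (i : ℕ) = p i}

/-- The quotient `log_{m+1} N_{β,m,n}(x) / n`, with `N_{β,m,n}(x)` the number of `n`-prefixes. -/
noncomputable def prefixRate (β : ℝ) (m : ℕ) (x : ℝ) (n : ℕ) : ℝ :=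
  Real.logb ((m : ℝ) + 1) ((betaPrefixes β m n x).ncard : ℝ) / n

noncomputable def lowerGrowthRate (β : ℝ) (m : ℕ) (x : ℝ) : ℝ :=
  Filter.liminf (prefixRate β m x) Filter.atTop

noncomputable def upperGrowthRate (β : ℝ) (m : ℕ) (x : ℝ) : ℝ :=
  Filter.limsup (prefixRate β m x) Filter.atTop

/-- `G` is a generalised golden ratio for `m`: for `β ∈ (1, G)` every `x ∈ (0, m/(β-1))` has
uncountably many `β`-expansions, and for `β ∈ (G, m+1]` (with `β > 1`) some `x ∈ (0, m/(β-1))` has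
exactly one. -/
def IsGeneralisedGoldenRatio (m : ℕ) (G : ℝ) : Prop :=
  (∀ β : ℝ, 1 < β → β < G → ∀ x ∈ Set.Ioo (0 : ℝ) (m / (β - 1)),
      ¬ (betaExpansions β m x).Countable) ∧
  (∀ β : ℝ, 1 < β → G < β → β ≤ m + 1 → ∃ x ∈ Set.Ioo (0 : ℝ) (m / (β - 1)),
      (betaExpansions β m x).encard = 1)

/-- `k + 1` if `m = 2k`, and `(k + 1 + √(k² + 6k + 5)) / 2` if `m = 2k + 1`; here `m / 2` is the
natural-number quotient `k`. -/
noncomputable def generalisedGoldenRatio (m : ℕ) : ℝ :=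
  if Even m then ((m / 2 : ℕ) : ℝ) + 1
  else (((m / 2 : ℕ) : ℝ) + 1 +
    √(((m / 2 : ℕ) : ℝ) ^ 2 + 6 * ((m / 2 : ℕ) : ℝ) + 5)) / 2

/-! Write L = m/(β-1). A β-expansion of x amounts to a choice of digits d for which the orbit under
t ↦ βt - d stays bounded. For β < G(m) there is a compact K = [a, L-a] from every point of which two
different words of one common length n lead back into K (`exists_forall_splits_two`). Iterating
codes a family of expansions by {0,1}^ℕ. Reading the code in base 2 is a Hölder map onto [0,1], so
the dimension is at least log 2 / (n log(m+1)) (`le_dimH_range_of_separated`); prefixes are counted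
by the same code. Every point of (0,L) enters K after finitely many digits 0 or m, which costs no
dimension and only a bounded error in the counts. Positive dimension gives uncountability.

For β > G(m) a fixed point (m even) or a 2-cycle (m odd) of the digit maps never has a choice of
digit, so its points have one expansion.

For uniformity in m with β fixed, once m is large against β² a suitable K offers at least √(m+1)
digits in a single step, so the rate is at least 1/2 (`exists_hasExpansionRate_of_large`). Only
finitely many m remain. -/

open Set Filter Topology

/-! ### Words of digits and splitting. -/

/-- The image of `y` under the successive maps `t ↦ β t - w i`, for `i = 0, …, n - 1`. -/
noncomputable def wordMap (β : ℝ) {m n : ℕ} (w : Fin n → Fin (m + 1)) (y : ℝ) : ℝ :=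
  β ^ n * (y - ∑ i : Fin n, ((w i : ℕ) : ℝ) / β ^ ((i : ℕ) + 1))

theorem wordMap_cons {β : ℝ} (hβ : β ≠ 0) {m n : ℕ} (d : Fin (m + 1)) (w : Fin n → Fin (m + 1))
    (y : ℝ) :
    wordMap β (Fin.cons d w : Fin (n + 1) → Fin (m + 1)) y = wordMap β w (β * y - (d : ℕ)) := by
  have h : ∑ i : Fin n, ((w i : ℕ) : ℝ) / β ^ ((i : ℕ) + 1) =
      β * ∑ i : Fin n, ((w i : ℕ) : ℝ) / β ^ ((i : ℕ) + 1 + 1) := by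
    rw [Finset.mul_sum]
    refine Finset.sum_congr rfl fun i _ => ?_
    field_simp
    ring
  simp only [wordMap, Fin.sum_univ_succ, Fin.cons_zero, Fin.cons_succ, Fin.val_zero, Fin.val_succ,
    h]
  field_simp
  ring

theorem wordMap_snoc {β : ℝ} (hβ : β ≠ 0) {m n : ℕ} (w : Fin n → Fin (m + 1)) (d : Fin (m + 1))
    (y : ℝ) :
    wordMap β (Fin.snoc w d : Fin (n + 1) → Fin (m + 1)) y = β * wordMap β w y - (d : ℕ) := by
  simp only [wordMap, Fin.sum_univ_castSucc, Fin.snoc_castSucc, Fin.snoc_last, Fin.val_castSucc,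
    Fin.val_last]
  field_simp
  ring

theorem wordMap_one {β : ℝ} (hβ : β ≠ 0) {m : ℕ} (w : Fin 1 → Fin (m + 1)) (y : ℝ) :
    wordMap β w y = β * y - (w 0 : ℕ) := by
  simp [wordMap]
  field_simp

/-- There are `M` distinct words of length `n` that send `y` into `K`. -/
def Splits (β : ℝ) (m : ℕ) (K : Set ℝ) (M n : ℕ) (y : ℝ) : Prop :=
  ∃ W : Fin M → Fin n → Fin (m + 1), Function.Injective W ∧ ∀ c, wordMap β (W c) y ∈ K

theorem Splits.cons {β : ℝ} (hβ : β ≠ 0) {m M n : ℕ} {K : Set ℝ} {y : ℝ} (d : Fin (m + 1))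
    (h : Splits β m K M n (β * y - (d : ℕ))) : Splits β m K M (n + 1) y := by
  obtain ⟨W, hW, hK⟩ := h
  refine ⟨fun c => Fin.cons d (W c), fun c c' hc => hW (Fin.cons_right_injective _ hc),
    fun c => ?_⟩
  rw [wordMap_cons hβ]
  exact hK c

theorem Splits.snoc {β : ℝ} (hβ : β ≠ 0) {m M n : ℕ} {K : Set ℝ}
    (stay : ∀ z ∈ K, ∃ d : Fin (m + 1), β * z - (d : ℕ) ∈ K) {y : ℝ}
    (h : Splits β m K M n y) : Splits β m K M (n + 1) y := by
  obtain ⟨W, hW, hK⟩ := h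
  choose d hd using fun c => stay _ (hK c)
  refine ⟨fun c => Fin.snoc (W c) (d c), fun c c' hc => hW ?_, fun c => ?_⟩
  · have := congrArg Fin.init hc
    simpa using this
  · rw [wordMap_snoc hβ]
    exact hd c

/-- Words can be lengthened inside K without losing distinctness, so points with different splitting
times get one common word length. -/
theorem Splits.of_le {β : ℝ} (hβ : β ≠ 0) {m M n n' : ℕ} {K : Set ℝ}
    (stay : ∀ z ∈ K, ∃ d : Fin (m + 1), β * z - (d : ℕ) ∈ K) {y : ℝ} (hn : n ≤ n')
    (h : Splits β m K M n y) : Splits β m K M n' y := by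
  induction n', hn using Nat.le_induction with
  | base => exact h
  | succ k _ ih => exact ih.snoc hβ stay

/-! ### Coding expansions by sequences of blocks. -/

section Blocks

variable {m M n : ℕ} (β : ℝ) (W : ℝ → Fin M → Fin n → Fin (m + 1)) (x : ℝ)

/-- The point reached from `x` after `j` blocks, when `c` selects the block at each stage. -/
noncomputable def blockState (c : ℕ → Fin M) : ℕ → ℝ
  | 0 => x
  | j + 1 => wordMap β (W (blockState c j) (c j)) (blockState c j)

/-- The concatenation of the blocks selected by `c`, starting at `x`. -/
noncomputable def blockSeq (hn : 0 < n) (c : ℕ → Fin M) : DigitSeq m := fun i =>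
  W (blockState β W x c (i / n)) (c (i / n)) ⟨i % n, Nat.mod_lt i hn⟩

theorem blockSeq_mul_add (hn : 0 < n) (c : ℕ → Fin M) (j : ℕ) (i : Fin n) :
    blockSeq β W x hn c (n * j + i) = W (blockState β W x c j) (c j) i := by
  have h1 : (n * j + i) / n = j := by
    rw [Nat.mul_add_div hn, Nat.div_eq_of_lt i.2, add_zero]
  have h2 : (⟨(n * j + i) % n, Nat.mod_lt _ hn⟩ : Fin n) = i := by
    ext
    simp [Nat.mod_eq_of_lt i.2]
  simp only [blockSeq, h1, h2]

theorem blockState_congr {c c' : ℕ → Fin M} {j : ℕ} (h : ∀ i < j, c i = c' i) :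
    blockState β W x c j = blockState β W x c' j := by
  induction j with
  | zero => rfl
  | succ j ih =>
    simp only [blockState, ih fun i hi => h i (hi.trans j.lt_succ_self), h j j.lt_succ_self]

theorem sum_blockSeq (hβ : β ≠ 0) (hn : 0 < n) (c : ℕ → Fin M) (j : ℕ) :
    ∑ i ∈ Finset.range (n * j), ((blockSeq β W x hn c i : ℕ) : ℝ) / β ^ (i + 1) =
      x - blockState β W x c j / β ^ (n * j) := by
  induction j with
  | zero => simp [blockState]
  | succ j ih =>
    have h : ∑ i ∈ Finset.range n,
        ((blockSeq β W x hn c (n * j + i) : ℕ) : ℝ) / β ^ (n * j + i + 1) =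
        (∑ i : Fin n, ((W (blockState β W x c j) (c j) i : ℕ) : ℝ) / β ^ ((i : ℕ) + 1)) /
          β ^ (n * j) := by
      rw [Finset.sum_range, Finset.sum_div]
      refine Finset.sum_congr rfl fun i _ => ?_
      rw [blockSeq_mul_add, div_div, ← pow_add]
      congr 2
      ring
    rw [mul_add, mul_one, Finset.sum_range_add, ih, h]
    simp only [blockState, wordMap]
    field_simp
    ring

theorem blockSeq_mem_betaExpansions {K : Set ℝ} {B : ℝ} (hβ : 1 < β) (hn : 0 < n)
    (hK : ∀ y ∈ K, |y| ≤ B) (hW : ∀ y ∈ K, ∀ c, wordMap β (W y c) y ∈ K) (hx : x ∈ K)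
    (c : ℕ → Fin M) : blockSeq β W x hn c ∈ betaExpansions β m x := by
  have hβ0 : 0 < β := by linarith
  have hmem : ∀ j, blockState β W x c j ∈ K := by
    intro j
    induction j with
    | zero => exact hx
    | succ j ih => exact hW _ ih _
  have hnonneg : ∀ i, 0 ≤ ((blockSeq β W x hn c i : ℕ) : ℝ) / β ^ (i + 1) := fun i => by positivity
  rw [betaExpansions, mem_ofPred_eq, hasSum_iff_tendsto_nat_of_nonneg hnonneg]
  have hsub : Tendsto (fun j : ℕ => n * j) atTop atTop := tendsto_id.const_mul_atTop' hn
  -- The terms are nonnegative, so convergence of the partial sums along multiples of n suffices;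
  -- there the remainder is a bounded state divided by β^(nj).
  rw [tendsto_iff_tendsto_subseq_of_monotone
    (monotone_nat_of_le_succ fun k => by
      rw [Finset.sum_range_succ]; exact le_add_of_nonneg_right (hnonneg k)) hsub]
  have h0 : Tendsto (fun j => blockState β W x c j / β ^ (n * j)) atTop (𝓝 0) := by
    have hB : Tendsto (fun j => B * (β⁻¹ ^ (n * j))) atTop (𝓝 0) := by
      have := ((tendsto_pow_atTop_nhds_zero_of_lt_one (r := β⁻¹) (by positivity)
        (inv_lt_one_of_one_lt₀ hβ)).comp hsub).const_mul B
      simpa using this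
    refine squeeze_zero_norm (fun j => ?_) hB
    rw [norm_div, norm_pow, Real.norm_eq_abs, Real.norm_eq_abs, abs_of_pos hβ0, inv_pow,
      ← div_eq_mul_inv]
    gcongr
    exact hK _ (hmem j)
  have := (tendsto_const_nhds (x := x)).sub h0
  rw [sub_zero] at this
  refine this.congr fun j => ?_
  exact (sum_blockSeq β W x hβ0.ne' hn c j).symm

/-- The state before block j depends only on the earlier letters, so both sequences choose block j
from the same injective family. -/
theorem exists_blockSeq_ne {K : Set ℝ} (hn : 0 < n)
    (hW : ∀ y ∈ K, ∀ c, wordMap β (W y c) y ∈ K)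
    (hinj : ∀ y ∈ K, Function.Injective (W y)) (hx : x ∈ K)
    {c c' : ℕ → Fin M} {j : ℕ} (h : ∀ i < j, c i = c' i) (hj : c j ≠ c' j) :
    ∃ i < n * (j + 1), blockSeq β W x hn c i ≠ blockSeq β W x hn c' i := by
  have hmem : ∀ j, blockState β W x c j ∈ K := by
    intro j
    induction j with
    | zero => exact hx
    | succ j ih => exact hW _ ih _
  obtain ⟨i, hi⟩ := Function.ne_iff.mp ((hinj _ (hmem j)).ne hj)
  refine ⟨n * j + i, by rw [mul_add, mul_one]; omega, ?_⟩
  rw [blockSeq_mul_add, blockSeq_mul_add, ← blockState_congr β W x h]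
  exact hi

end Blocks

/-! ### Dimension and prefix counts of a coded family. -/

theorem dist_digitSeq_of_ne {m : ℕ} {ε δ : DigitSeq m} (h : ε ≠ δ) :
    dist ε δ =
      (((m : ℝ) + 1) ^ (PiNat.firstDiff (E := fun _ => Fin (m + 1)) ε δ + 1))⁻¹ :=
  if_neg h

theorem le_dist_digitSeq {m N i : ℕ} {ε δ : DigitSeq m} (hi : i < N) (h : ε i ≠ δ i) :
    (((m : ℝ) + 1) ^ N)⁻¹ ≤ dist ε δ := by
  have hne : ε ≠ δ := fun e => h (by rw [e])
  rw [dist_digitSeq_of_ne hne]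
  refine inv_anti₀ (by positivity) (pow_le_pow_right₀ (by simp) ?_)
  have : PiNat.firstDiff (E := fun _ => Fin (m + 1)) ε δ ≤ i := by
    by_contra hlt
    exact h (PiNat.apply_eq_of_lt_firstDiff (not_le.mp hlt))
  exact Nat.succ_le_of_lt (this.trans_lt hi)

/-- A family of digit sequences coded by `{0, …, M - 1}^ℕ`, in which the first `j + 1` code
letters can be read off from the first `n (j + 1)` digits, has dimension at least
`log M / (n log (m + 1))`. -/
theorem le_dimH_range_of_separated {m M n : ℕ} (hm : 1 ≤ m) (hM : 2 ≤ M) (hn : 0 < n)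
    (g : (ℕ → Fin M) → DigitSeq m)
    (hg : ∀ c c' : ℕ → Fin M, ∀ j, (∀ i < j, c i = c' i) → c j ≠ c' j →
      ∃ i < n * (j + 1), g c i ≠ g c' i) :
    ENNReal.ofReal (Real.logb ((m : ℝ) + 1) M / n) ≤ dimH (range g) := by
  have hm1 : (1 : ℝ) < (m : ℝ) + 1 := by
    have : (1 : ℝ) ≤ m := by exact_mod_cast hm
    linarith
  have hM1 : (1 : ℝ) < M := by exact_mod_cast hM
  have hM0 : (0 : ℝ) < M := by linarith
  have hn0 : (0 : ℝ) < n := by exact_mod_cast hn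
  set r : ℝ := Real.logb ((m : ℝ) + 1) M / n with hr
  have hr0 : 0 < r := div_pos (Real.logb_pos hm1 hM1) hn0
  have hfirst : ∀ c c' : ℕ → Fin M, c ≠ c' → ∃ j, (∀ i < j, c i = c' i) ∧ c j ≠ c' j :=
    fun c c' hc => ⟨PiNat.firstDiff c c', fun i hi => PiNat.apply_eq_of_lt_firstDiff hi,
      PiNat.apply_firstDiff_ne hc⟩
  have hinj : Function.Injective g := by
    intro c c' h
    by_contra hc
    obtain ⟨j, h1, h2⟩ := hfirst c c' hc
    obtain ⟨i, -, hi⟩ := hg c c' j h1 h2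
    exact hi (by rw [h])
  have : Nonempty (Fin M) := ⟨⟨0, by omega⟩⟩
  -- On the range of `g` this recovers the code and reads it as a base-M expansion.
  set f : DigitSeq m → ℝ := fun ε => Real.ofDigits (Function.invFun g ε) with hf
  have hfg : ∀ c, f (g c) = Real.ofDigits c := fun c => by
    simp only [hf, Function.leftInverse_invFun hinj c]
  -- The exponent r is chosen so that n digits of distance weigh exactly one base-M letter.
  have hpow : ∀ j : ℕ, ((((m : ℝ) + 1) ^ (n * (j + 1)))⁻¹) ^ r = ((M : ℝ) ^ (j + 1))⁻¹ := by
    intro j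
    rw [Real.inv_rpow (by positivity), ← Real.rpow_natCast, ← Real.rpow_mul (by positivity)]
    congr 1
    have : ((n * (j + 1) : ℕ) : ℝ) * r = Real.logb ((m : ℝ) + 1) M * ((j + 1 : ℕ) : ℝ) := by
      rw [hr]
      push_cast
      field_simp
    rw [this, Real.rpow_mul (by positivity), Real.rpow_logb (by positivity) hm1.ne' hM0,
      Real.rpow_natCast]
  have hhol : HolderOnWith (M : NNReal) r.toNNReal f (range g) := by
    rintro _ ⟨c, rfl⟩ _ ⟨c', rfl⟩
    rw [hfg, hfg]
    by_cases hc : c = c'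
    · simp [hc]
    obtain ⟨j, h1, h2⟩ := hfirst c c' hc
    obtain ⟨i, hi, hne⟩ := hg c c' j h1 h2
    have hd := le_dist_digitSeq hi hne
    have hreal : dist (Real.ofDigits c) (Real.ofDigits c') ≤ M * dist (g c) (g c') ^ r := by
      -- The Hölder constant M pays for the shift from j common letters to the j + 1 letters that
      -- separate the sequences.
      calc dist (Real.ofDigits c) (Real.ofDigits c') ≤ ((M : ℝ) ^ j)⁻¹ :=
            Real.abs_ofDigits_sub_ofDigits_le h1
        _ = M * ((M : ℝ) ^ (j + 1))⁻¹ := by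
            field_simp
            ring
        _ = M * ((((m : ℝ) + 1) ^ (n * (j + 1)))⁻¹) ^ r := by rw [hpow]
        _ ≤ M * dist (g c) (g c') ^ r := by gcongr
    rw [edist_dist, edist_dist, Real.coe_toNNReal _ hr0.le,
      ENNReal.ofReal_rpow_of_nonneg dist_nonneg hr0.le]
    refine (ENNReal.ofReal_le_ofReal hreal).trans ?_
    rw [ENNReal.ofReal_mul hM0.le, ENNReal.ofReal_natCast]
    simp
  have himage : Icc (0 : ℝ) 1 ⊆ f '' range g := by
    intro y hy
    obtain ⟨c, -, rfl⟩ := Real.ofDigits_SurjOn (b := M) (by omega) hy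
    exact ⟨g c, mem_range_self c, hfg c⟩
  have hone : dimH (Icc (0 : ℝ) 1) = 1 := by
    rw [Real.dimH_of_nonempty_interior (by simp)]
    simp
  have hle : (1 : ENNReal) ≤ dimH (range g) / r.toNNReal := by
    rw [← hone]
    exact (dimH_mono himage).trans (hhol.dimH_image_le (Real.toNNReal_pos.mpr hr0))
  have hr' : (r.toNNReal : ENNReal) ≠ 0 := by simpa using hr0
  rw [ENNReal.le_div_iff_mul_le (Or.inl hr') (Or.inl ENNReal.coe_ne_top), one_mul] at hle
  exact hle

theorem pow_le_ncard_betaPrefixes {β x : ℝ} {m M n : ℕ}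
    (g : (ℕ → Fin M) → DigitSeq m) (hM : 0 < M)
    (hmem : ∀ c, g c ∈ betaExpansions β m x)
    (hg : ∀ c c' : ℕ → Fin M, ∀ j, (∀ i < j, c i = c' i) → c j ≠ c' j →
      ∃ i < n * (j + 1), g c i ≠ g c' i) {l j : ℕ} (hl : n * j ≤ l) :
    M ^ j ≤ (betaPrefixes β m l x).ncard := by
  let pad : (Fin j → Fin M) → ℕ → Fin M := fun c i => if h : i < j then c ⟨i, h⟩ else ⟨0, hM⟩
  let F : (Fin j → Fin M) → Fin l → Fin (m + 1) := fun c i => g (pad c) i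
  have hF : Function.Injective F := by
    intro c c' h
    by_contra hc
    have hne : pad c ≠ pad c' := by
      obtain ⟨i, hi⟩ := Function.ne_iff.mp hc
      refine Function.ne_iff.mpr ⟨i, ?_⟩
      simpa [pad] using hi
    set k := PiNat.firstDiff (E := fun _ => Fin M) (pad c) (pad c') with hk
    have hkne : pad c k ≠ pad c' k := PiNat.apply_firstDiff_ne hne
    have hkj : k < j := by
      by_contra hkj
      simp [pad, hkj] at hkne
    obtain ⟨i, hi, hine⟩ := hg _ _ k (fun i hi => PiNat.apply_eq_of_lt_firstDiff
      (E := fun _ => Fin M) hi) hkne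
    have hil : i < l := hi.trans_le ((Nat.mul_le_mul_left n hkj).trans hl)
    exact hine (congrFun h ⟨i, hil⟩)
  have hsub : range F ⊆ betaPrefixes β m l x := by
    rintro _ ⟨c, rfl⟩
    exact ⟨g (pad c), hmem _, fun i => rfl⟩
  calc M ^ j = (range F).ncard := by
        rw [← image_univ, ncard_image_of_injective _ hF, ncard_univ]
        simp
    _ ≤ _ := ncard_le_ncard hsub (toFinite _)

/-- The `β`-expansions of `x` have dimension at least `r`, and their `l`-prefixes number at least
a constant times `(m + 1) ^ (r l)`. -/
def HasExpansionRate (β : ℝ) (m : ℕ) (r x : ℝ) : Prop :=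
  ENNReal.ofReal r ≤ dimH (betaExpansions β m x) ∧
    ∃ C : ℝ, 0 ≤ C ∧ ∀ l : ℕ,
      l * r - C ≤ Real.logb ((m : ℝ) + 1) ((betaPrefixes β m l x).ncard : ℝ)

theorem hasExpansionRate_of_splits {β B x : ℝ} {m M n : ℕ} {K : Set ℝ} (hβ : 1 < β) (hm : 1 ≤ m)
    (hM : 2 ≤ M) (hn : 0 < n) (hK : ∀ y ∈ K, |y| ≤ B) (hs : ∀ y ∈ K, Splits β m K M n y)
    (hx : x ∈ K) : HasExpansionRate β m (Real.logb ((m : ℝ) + 1) M / n) x := by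
  have hm1 : (1 : ℝ) < (m : ℝ) + 1 := by
    have : (1 : ℝ) ≤ m := by exact_mod_cast hm
    linarith
  have hM1 : (1 : ℝ) < M := by exact_mod_cast hM
  have hn0 : (0 : ℝ) < n := by exact_mod_cast hn
  have : ∃ W : ℝ → Fin M → Fin n → Fin (m + 1), ∀ y ∈ K,
      Function.Injective (W y) ∧ ∀ c, wordMap β (W y c) y ∈ K := by
    classical
    -- The value off K is irrelevant, since orbits starting in K stay there.
    exact ⟨fun y => if h : y ∈ K then (hs y h).choose else fun _ _ => 0, fun y hy => by
      simpa [hy] using (hs y hy).choose_spec⟩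
  obtain ⟨W, hW⟩ := this
  have hmem : ∀ c, blockSeq β W x hn c ∈ betaExpansions β m x :=
    blockSeq_mem_betaExpansions β W x hβ hn hK (fun y hy => (hW y hy).2) hx
  have hsep : ∀ c c' : ℕ → Fin M, ∀ j, (∀ i < j, c i = c' i) → c j ≠ c' j →
      ∃ i < n * (j + 1), blockSeq β W x hn c i ≠ blockSeq β W x hn c' i := fun c c' j h h' =>
    exists_blockSeq_ne β W x hn (fun y hy => (hW y hy).2) (fun y hy => (hW y hy).1) hx h h'
  have hlog : 0 < Real.logb ((m : ℝ) + 1) M := Real.logb_pos hm1 hM1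
  -- The error log M covers the incomplete last block.
  refine ⟨(le_dimH_range_of_separated hm hM hn _ hsep).trans (dimH_mono ?_),
    Real.logb ((m : ℝ) + 1) M, hlog.le, fun l => ?_⟩
  · rintro _ ⟨c, rfl⟩
    exact hmem c
  · have hcard := pow_le_ncard_betaPrefixes (blockSeq β W x hn) (by omega) hmem hsep
      (Nat.mul_div_le l n)
    have hdiv : (l : ℝ) / n - 1 ≤ ((l / n : ℕ) : ℝ) := by
      have h1 : l < n * (l / n + 1) := Nat.lt_mul_div_succ l hn
      have h2 : (l : ℝ) < n * ((l / n : ℕ) + 1) := by exact_mod_cast h1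
      rw [sub_le_iff_le_add, div_le_iff₀ hn0]
      linarith
    calc l * (Real.logb ((m : ℝ) + 1) M / n) - Real.logb ((m : ℝ) + 1) M
        = ((l : ℝ) / n - 1) * Real.logb ((m : ℝ) + 1) M := by ring
      _ ≤ ((l / n : ℕ) : ℝ) * Real.logb ((m : ℝ) + 1) M := by gcongr
      _ = Real.logb ((m : ℝ) + 1) ((M : ℝ) ^ (l / n)) := by rw [Real.logb_pow]
      _ ≤ _ := Real.logb_le_logb_of_le hm1 (by positivity) (by exact_mod_cast hcard)

/-! ### Prepending digits, and passage to growth rates. -/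

/-- Prepending a digit to a digit sequence. -/
def digitCons {m : ℕ} (d : Fin (m + 1)) (ε : DigitSeq m) : DigitSeq m
  | 0 => d
  | i + 1 => ε i

theorem digitCons_mem_betaExpansions {β x : ℝ} {m : ℕ} (hβ : β ≠ 0) {d : Fin (m + 1)}
    {ε : DigitSeq m} (h : ε ∈ betaExpansions β m (β * x - (d : ℕ))) :
    digitCons d ε ∈ betaExpansions β m x := by
  change HasSum _ _ at h
  change HasSum _ _
  rw [← hasSum_nat_add_iff' 1]
  have hx : x - ∑ i ∈ Finset.range 1, ((digitCons d ε i : ℕ) : ℝ) / β ^ (i + 1) =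
      (β * x - (d : ℕ)) / β := by
    simp [digitCons]
    field_simp
  rw [hx]
  have hf : (fun i => ((digitCons d ε (i + 1) : ℕ) : ℝ) / β ^ (i + 1 + 1)) =
      fun i => ((ε i : ℕ) : ℝ) / β ^ (i + 1) / β :=
    funext fun i => by rw [digitCons, div_div, ← pow_succ]
  rw [hf]
  exact h.div_const β

theorem tail_mem_betaExpansions {β x : ℝ} {m : ℕ} (hβ : β ≠ 0) {ε : DigitSeq m}
    (h : ε ∈ betaExpansions β m x) :
    (fun i => ε (i + 1) : DigitSeq m) ∈ betaExpansions β m (β * x - (ε 0 : ℕ)) := by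
  change HasSum _ _ at h
  change HasSum _ _
  rw [← hasSum_nat_add_iff' 1] at h
  have hx : β * x - (ε 0 : ℕ) =
      β * (x - ∑ i ∈ Finset.range 1, ((ε i : ℕ) : ℝ) / β ^ (i + 1)) := by
    simp
    field_simp
  rw [hx]
  have hf : (fun i => ((ε (i + 1) : ℕ) : ℝ) / β ^ (i + 1)) =
      fun i => β * (((ε (i + 1) : ℕ) : ℝ) / β ^ (i + 1 + 1)) :=
    funext fun i => by rw [pow_succ β (i + 1)]; field_simp
  rw [hf]
  exact h.mul_left β

theorem antilipschitzWith_digitCons {m : ℕ} (d : Fin (m + 1)) :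
    AntilipschitzWith ((m : NNReal) + 1) (digitCons d) := by
  refine AntilipschitzWith.of_le_mul_dist fun ε δ => ?_
  by_cases h : ε = δ
  · simp [h]
  have hi := PiNat.apply_firstDiff_ne (E := fun _ => Fin (m + 1)) h
  set k := PiNat.firstDiff (E := fun _ => Fin (m + 1)) ε δ with hk
  have h1 : dist ε δ = (((m : ℝ) + 1) ^ (k + 1))⁻¹ := dist_digitSeq_of_ne h
  have h2 := le_dist_digitSeq (ε := digitCons d ε) (δ := digitCons d δ) (k + 1).lt_succ_self hi
  calc dist ε δ = ((m : ℝ) + 1) * (((m : ℝ) + 1) ^ (k + 1 + 1))⁻¹ := by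
        rw [h1]
        field_simp
        ring
    _ ≤ ((m : ℝ) + 1) * dist (digitCons d ε) (digitCons d δ) := by gcongr
    _ = _ := by simp

theorem logb_natCast_mono {b : ℝ} (hb : 1 < b) {p q : ℕ} (h : p ≤ q) :
    Real.logb b p ≤ Real.logb b q := by
  rcases Nat.eq_zero_or_pos p with rfl | hp
  · rw [Nat.cast_zero, Real.logb_zero]
    exact div_nonneg (Real.log_natCast_nonneg q) (Real.log_pos hb).le
  · exact Real.logb_le_logb_of_le hb (by exact_mod_cast hp) (by exact_mod_cast h)

theorem ncard_betaPrefixes_le_succ {β x : ℝ} {m : ℕ} (hβ : β ≠ 0) (d : Fin (m + 1)) (l : ℕ) :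
    (betaPrefixes β m l (β * x - (d : ℕ))).ncard ≤ (betaPrefixes β m (l + 1) x).ncard := by
  refine ncard_le_ncard_of_injOn (fun p => (Fin.cons d p : Fin (l + 1) → Fin (m + 1))) ?_
    (fun p _ q _ h => Fin.cons_right_injective _ h) (toFinite _)
  rintro p ⟨ε, hε, hp⟩
  refine ⟨digitCons d ε, digitCons_mem_betaExpansions hβ hε, fun i => ?_⟩
  refine Fin.cases rfl (fun i => ?_) i
  exact hp i

/-- Prepending is antilipschitz, so dimension does not drop; the prefix index shifts by one, which
adds r to the error constant. -/
theorem HasExpansionRate.of_digit {β x r : ℝ} {m : ℕ} (hβ : β ≠ 0) (hm : 1 ≤ m) (hr : 0 ≤ r)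
    (d : Fin (m + 1)) (h : HasExpansionRate β m r (β * x - (d : ℕ))) :
    HasExpansionRate β m r x := by
  have hm1 : (1 : ℝ) < (m : ℝ) + 1 := by
    have : (1 : ℝ) ≤ m := by exact_mod_cast hm
    linarith
  obtain ⟨h1, C, hC, h2⟩ := h
  refine ⟨h1.trans (((antilipschitzWith_digitCons d).le_dimH_image _).trans (dimH_mono ?_)),
    C + r, by positivity, fun l => ?_⟩
  · rintro _ ⟨ε, hε, rfl⟩
    exact digitCons_mem_betaExpansions hβ hε
  · cases l with
    | zero =>
      have : 0 ≤ Real.logb ((m : ℝ) + 1) ((betaPrefixes β m 0 x).ncard : ℝ) :=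
        div_nonneg (Real.log_natCast_nonneg _) (Real.log_pos hm1).le
      push_cast
      linarith
    | succ l =>
      have h3 := h2 l
      have h4 := logb_natCast_mono hm1 (ncard_betaPrefixes_le_succ (x := x) hβ d l)
      push_cast
      linarith

theorem HasExpansionRate.growth {β x r : ℝ} {m : ℕ} (hm : 1 ≤ m) (hr : 0 < r)
    (h : HasExpansionRate β m r x) :
    ENNReal.ofReal (r / 2) ≤ dimH (betaExpansions β m x) ∧
      r / 2 ≤ lowerGrowthRate β m x ∧ r / 2 ≤ upperGrowthRate β m x := by
  have hm1 : (1 : ℝ) < (m : ℝ) + 1 := by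
    have : (1 : ℝ) ≤ m := by exact_mod_cast hm
    linarith
  obtain ⟨h1, C, hC, h2⟩ := h
  -- Giving up half the rate absorbs C as soon as l ≥ 2C/r.
  have hev : ∀ᶠ l : ℕ in atTop, r / 2 ≤ prefixRate β m x l := by
    obtain ⟨N, hN⟩ := exists_nat_ge (2 * C / r)
    filter_upwards [eventually_ge_atTop (N + 1)] with l hl
    have hl' : ((N : ℝ) + 1) ≤ l := by exact_mod_cast hl
    have hl0 : (0 : ℝ) < l := by have := Nat.cast_nonneg (α := ℝ) N; linarith
    rw [prefixRate, le_div_iff₀ hl0]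
    refine le_trans ?_ (h2 l)
    rw [div_le_iff₀ hr] at hN
    nlinarith
  -- This upper bound supplies the boundedness that real-valued `liminf` and `limsup` need to be
  -- meaningful.
  have hle : ∀ l, prefixRate β m x l ≤ 1 := by
    intro l
    rw [prefixRate]
    refine div_le_one_of_le₀ ?_ (Nat.cast_nonneg l)
    have hcard : (betaPrefixes β m l x).ncard ≤ (m + 1) ^ l := by
      refine (ncard_le_ncard (subset_univ _) (toFinite _)).trans ?_
      rw [ncard_univ]
      simp
    refine (logb_natCast_mono hm1 hcard).trans (le_of_eq ?_)
    push_cast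
    rw [Real.logb_pow, Real.logb_self_eq_one hm1, mul_one]
  have hb : IsBoundedUnder (· ≤ ·) atTop (prefixRate β m x) := isBoundedUnder_of ⟨1, hle⟩
  refine ⟨(ENNReal.ofReal_le_ofReal (by linarith)).trans h1, ?_, ?_⟩
  · exact le_liminf_of_le hb.isCoboundedUnder_ge hev
  · exact le_limsup_of_frequently_le hev.frequently hb

/-! ### The trapping interval and its splittings. -/

/-- Every interior point is carried into `[a, L - a]` by repeating the digit `0` or the digit
`m`. -/
theorem of_mem_Icc_of_digit {β a L : ℝ} {m : ℕ} (hβ : 1 < β) (hL : β * L = L + m) (ha : 0 < a)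
    (haL : β * a ≤ L - a) {P : ℝ → Prop}
    (hP : ∀ (d : Fin (m + 1)) (x : ℝ), P (β * x - (d : ℕ)) → P x)
    (hK : ∀ x ∈ Icc a (L - a), P x) {x : ℝ} (hx : x ∈ Ioo 0 L) : P x := by
  -- Both ends are treated at once: `f` is the identity with digit 0, or the reflection u ↦ L - u
  -- with digit m.
  have climb : ∀ (f : ℝ → ℝ) (d : Fin (m + 1)), (∀ u, β * f u - (d : ℕ) = f (β * u)) →
      (∀ u ∈ Icc a (L - a), P (f u)) →
      ∀ (n : ℕ) (u : ℝ), 0 < u → u ≤ L - a → a ≤ β ^ n * u → P (f u) := by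
    intro f d hf hfK n
    induction n with
    | zero =>
      intro u _ h2 h3
      exact hfK u ⟨by simpa using h3, h2⟩
    | succ n ih =>
      intro u h1 h2 h3
      rcases le_or_gt a u with h | h
      · exact hfK u ⟨h, h2⟩
      · refine hP d _ ?_
        rw [hf]
        refine ih (β * u) (by positivity) ?_ (by rw [← mul_assoc, ← pow_succ]; exact h3)
        -- Since u < a, one step cannot jump over the interval.
        exact (mul_le_mul_of_nonneg_left h.le (by linarith)).trans haL
  have hpow : ∀ u : ℝ, 0 < u → ∃ n : ℕ, a ≤ β ^ n * u := by
    intro u hu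
    obtain ⟨n, hn⟩ := pow_unbounded_of_one_lt (a / u) hβ
    exact ⟨n, by rw [div_lt_iff₀ hu] at hn; exact hn.le⟩
  rcases le_or_gt x (L - a) with h | h
  · obtain ⟨n, hn⟩ := hpow x hx.1
    exact climb id 0 (by simp) hK n x hx.1 h hn
  · obtain ⟨n, hn⟩ := hpow (L - x) (by linarith [hx.2])
    have := climb (fun u => L - u) (Fin.last m) (fun u => by simp only [Fin.val_last]; linarith)
      (fun u hu => hK _ ⟨by linarith [hu.2], by linarith [hu.1]⟩) n (L - x) (by linarith [hx.2])
      (by nlinarith) hn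
    simpa using this

/-- The interval has length at least 1, so its integer translates leave no gaps. -/
theorem exists_digit_mem_Icc {β a L : ℝ} {m : ℕ} (hβ : 1 < β) (hL : β * L = L + m) (ha : 0 < a)
    (h1 : 1 + 2 * a ≤ L) {y : ℝ} (hy : y ∈ Icc a (L - a)) :
    ∃ d : Fin (m + 1), β * y - (d : ℕ) ∈ Icc a (L - a) := by
  obtain ⟨hya, hyL⟩ := hy
  rcases le_or_gt (β * y) (L - a) with h | h
  · exact ⟨0, by simp; exact ⟨by nlinarith, h⟩⟩
  rcases le_or_gt (m + a) (β * y) with h' | h'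
  · refine ⟨Fin.last m, ?_⟩
    simp only [Fin.val_last]
    exact ⟨by linarith, by nlinarith⟩
  · have hpos : 0 < β * y - L + a := by linarith
    have hc := Nat.ceil_lt_add_one hpos.le
    have hc' := Nat.le_ceil (β * y - L + a)
    refine ⟨⟨⌈β * y - L + a⌉₊, ?_⟩, ?_, ?_⟩
    · have : ((⌈β * y - L + a⌉₊ : ℕ) : ℝ) < ((m + 1 : ℕ) : ℝ) := by
        push_cast
        linarith
      exact_mod_cast this
    · simp only
      linarith
    · simp only
      linarith

theorem splits_two_one {β y : ℝ} (hβ : β ≠ 0) {m : ℕ} {K : Set ℝ} {d d' : ℕ} (hd : d ≤ m)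
    (hd' : d' ≤ m) (hne : d ≠ d') (h : β * y - d ∈ K) (h' : β * y - d' ∈ K) :
    Splits β m K 2 1 y := by
  refine ⟨![fun _ => ⟨d, by omega⟩, fun _ => ⟨d', by omega⟩], ?_, ?_⟩
  · intro i j hij
    have hval := congrArg Fin.val (congrFun hij 0)
    fin_cases i <;> fin_cases j
    · rfl
    · exact (hne hval).elim
    · exact (hne hval.symm).elim
    · rfl
  · intro i
    rw [wordMap_one hβ]
    fin_cases i
    · exact h
    · exact h'

/-- A point of `[a, L - a]` from which neither end of the interval is too close splits within two
steps. -/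
theorem splits_two_two {β a L : ℝ} {m : ℕ} (hβ : 1 < β) (hL : β * L = L + m) (ha : 0 < a)
    (h1 : 1 + 2 * a ≤ L)
    (hgap : 2 + 2 * a ≤ L ∨ ∃ k : ℕ, m = 2 * k + 1 ∧ k + 1 + a ≤ β * (L - 1 - a))
    {y : ℝ} (hy : y ∈ Icc a (L - a)) (hlo : 1 + a ≤ β * y) (hhi : 1 + a ≤ β * (L - y)) :
    Splits β m (Icc a (L - a)) 2 2 y := by
  have hβ0 : β ≠ 0 := by linarith
  have stay := fun z (hz : z ∈ Icc a (L - a)) => exists_digit_mem_Icc hβ hL ha h1 hz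
  obtain ⟨⟨d, hdm⟩, hd⟩ := stay y hy
  simp only at hd
  have hdm' : d ≤ m := by omega
  obtain ⟨hz1, hz2⟩ := hd
  by_cases hup : 1 + a ≤ β * y - d ∧ d + 1 ≤ m
  · refine (splits_two_one (K := Icc a (L - a)) (d := d) (d' := d + 1) hβ0 hdm' hup.2
      (by omega) ⟨hz1, hz2⟩ ?_).snoc hβ0 stay
    push_cast
    exact ⟨by linarith [hup.1], by linarith⟩
  by_cases hdown : β * y - d ≤ L - a - 1 ∧ 1 ≤ d
  · obtain ⟨e, rfl⟩ : ∃ e, d = e + 1 := ⟨d - 1, by omega⟩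
    push_cast at *
    refine (splits_two_one (K := Icc a (L - a)) (d := e + 1) (d' := e) hβ0 hdm' (by omega)
      (by omega) ?_ ?_).snoc hβ0 stay
    · push_cast
      exact ⟨hz1, hz2⟩
    · exact ⟨by linarith, by linarith [hdown.1]⟩
  have hd0 : 1 ≤ d := by
    by_contra h
    obtain rfl : d = 0 := by omega
    by_cases hm : m = 0
    · subst hm
      simp at hL
      nlinarith
    · exact hup ⟨by simpa using hlo, by omega⟩
  have hz3 : L - a - 1 < β * y - d := by
    by_contra h
    exact hdown ⟨by linarith, hd0⟩
  have hdm1 : d + 1 ≤ m := by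
    by_contra h
    obtain rfl : d = m := by omega
    nlinarith
  have hz4 : β * y - d < 1 + a := by
    by_contra h
    exact hup ⟨by linarith, hdm1⟩
  -- Neither neighbour of d is admissible, so z lies in (L-1-a, 1+a). This is empty if L ≥ 2 + 2a;
  -- otherwise the odd case applies, and the next step from z allows both middle digits k and k + 1.
  rcases hgap with h2 | ⟨k, hk, hgap⟩
  · linarith
  have hkm : (m : ℝ) = 2 * k + 1 := by rw [hk]; push_cast; ring
  refine Splits.cons hβ0 ⟨d, hdm⟩ ?_
  simp only
  set z := β * y - d with hz
  have h5 : k + 1 + a ≤ β * z :=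
    hgap.trans (mul_le_mul_of_nonneg_left (by linarith) (by linarith))
  have h6 : β * z ≤ L + k - a := by
    have : β * z ≤ β * (1 + a) := mul_le_mul_of_nonneg_left hz4.le (by linarith)
    linarith
  refine splits_two_one (d := k) (d' := k + 1) hβ0 (by omega) (by omega) (by omega) ?_ ?_
  · exact ⟨by linarith, by linarith⟩
  · push_cast
    exact ⟨by linarith, by linarith⟩

theorem exists_forall_splits_two {β a L : ℝ} {m : ℕ} (hβ : 1 < β) (hL : β * L = L + m)
    (ha : 0 < a) (h1 : 1 + 2 * a ≤ L) (h3 : (β + 1) * (1 + a) ≤ β * L)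
    (hgap : 2 + 2 * a ≤ L ∨ ∃ k : ℕ, m = 2 * k + 1 ∧ k + 1 + a ≤ β * (L - 1 - a)) :
    ∃ n, 0 < n ∧ ∀ y ∈ Icc a (L - a), Splits β m (Icc a (L - a)) 2 n y := by
  have hβ0 : β ≠ 0 := by linarith
  have stay := fun z (hz : z ∈ Icc a (L - a)) => exists_digit_mem_Icc hβ hL ha h1 hz
  have climb : ∀ (f : ℝ → ℝ) (d : Fin (m + 1)), (∀ u, β * f u - (d : ℕ) = f (β * u)) →
      (∀ u ∈ Icc a (L - a), 1 + a ≤ β * u → 1 + a ≤ β * (L - u) →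
        Splits β m (Icc a (L - a)) 2 2 (f u)) →
      ∀ (n : ℕ) (u : ℝ), u ∈ Icc a (L - a) → 1 + a ≤ β * (L - u) → 1 + a ≤ β ^ (n + 1) * u →
        Splits β m (Icc a (L - a)) 2 (n + 2) (f u) := by
    intro f d hf hmid n
    induction n with
    | zero =>
      intro u h4 h5 h6
      exact hmid u h4 (by simpa using h6) h5
    | succ n ih =>
      intro u h4 h5 h6
      rcases le_or_gt (1 + a) (β * u) with h | h
      · exact (hmid u h4 h h5).of_le hβ0 stay (by omega)
      · refine Splits.cons hβ0 d ?_
        rw [hf]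
        -- With βu < 1 + a, the hypothesis `h3` keeps the image far enough from the opposite end.
        refine ih (β * u) ⟨?_, by linarith⟩ ?_ (by rw [← mul_assoc, ← pow_succ]; exact h6)
        · nlinarith [h4.1]
        · nlinarith
  obtain ⟨n, hn⟩ := pow_unbounded_of_one_lt ((1 + a) / a) hβ
  have hpow : ∀ u, a ≤ u → 1 + a ≤ β ^ (n + 1) * u := by
    intro u hu
    rw [div_lt_iff₀ ha] at hn
    calc 1 + a ≤ β ^ n * a := hn.le
      _ ≤ β ^ (n + 1) * u := by
        gcongr
        · exact hβ.le
        · omega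
  refine ⟨n + 2, by omega, fun y hy => ?_⟩
  rcases le_or_gt (1 + a) (β * (L - y)) with h | h
  · exact climb id 0 (by simp) (fun u hu hu1 hu2 => splits_two_two hβ hL ha h1 hgap hu hu1 hu2)
      n y hy h (hpow y hy.1)
  · have := climb (fun u => L - u) (Fin.last m) (fun u => by simp only [Fin.val_last]; linarith)
      (fun u hu hu1 hu2 => splits_two_two hβ hL ha h1 hgap
        ⟨by linarith [hu.2], by linarith [hu.1]⟩ hu2 (by simpa using hu1)) n (L - y)
      ⟨by linarith [hy.2], by linarith [hy.1]⟩ (by nlinarith) (hpow _ (by linarith [hy.2]))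
    simpa using this

/-- The equality βa = L - a makes β map K onto [L-a, m+a], so every integer d with βy - d in K is
automatically a digit in {0, …, m}. An interval of length at least M contains M such integers. -/
theorem splits_of_length {β a L : ℝ} {m M : ℕ} (hβ : 1 < β) (hL : β * L = L + m)
    (haL : β * a = L - a) (hM : M ≤ L - 2 * a) {y : ℝ} (hy : y ∈ Icc a (L - a)) :
    Splits β m (Icc a (L - a)) M 1 y := by
  have hβ0 : β ≠ 0 := by linarith
  have hpos : 0 ≤ β * y - (L - a) := by nlinarith [hy.1]
  have hc := Nat.ceil_lt_add_one hpos
  have hc' := Nat.le_ceil (β * y - (L - a))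
  set e := ⌈β * y - (L - a)⌉₊ with he
  have hle : ∀ c : Fin M, ((e + c : ℕ) : ℝ) ≤ β * y - a := by
    intro c
    have : ((c : ℕ) : ℝ) + 1 ≤ M := by exact_mod_cast c.2
    push_cast
    linarith
  have hm : ∀ c : Fin M, e + c < m + 1 := by
    intro c
    have : ((e + c : ℕ) : ℝ) ≤ m := (hle c).trans (by nlinarith [hy.2])
    have : e + c ≤ m := by exact_mod_cast this
    omega
  refine ⟨fun c _ => ⟨e + c, hm c⟩, ?_, ?_⟩
  · intro c c' h
    have := congrFun h 0
    simp only [Fin.mk.injEq] at this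
    exact Fin.ext (by omega)
  · intro c
    rw [wordMap_one hβ0]
    have h1 := hle c
    refine ⟨?_, ?_⟩
    · simp only
      linarith
    · simp only
      push_cast
      have : (0 : ℝ) ≤ ((c : ℕ) : ℝ) := by positivity
      linarith

/-! ### The golden ratio threshold and the resulting rates. -/

theorem mul_div_sub_one {β : ℝ} (hβ : 1 < β) (m : ℕ) :
    β * (m / (β - 1)) = m / (β - 1) + m := by
  have : β - 1 ≠ 0 := by linarith
  field_simp
  ring

theorem hasExpansionRate_of_forall_splits {β a x : ℝ} {m M n : ℕ} (hβ : 1 < β) (hm : 1 ≤ m)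
    (hM : 2 ≤ M) (hn : 0 < n) (ha : 0 < a) (haL : β * a ≤ m / (β - 1) - a)
    (hs : ∀ y ∈ Icc a (m / (β - 1) - a), Splits β m (Icc a (m / (β - 1) - a)) M n y)
    (hx : x ∈ Ioo 0 (m / (β - 1))) :
    HasExpansionRate β m (Real.logb ((m : ℝ) + 1) M / n) x := by
  have hr : 0 ≤ Real.logb ((m : ℝ) + 1) M / n := by
    refine div_nonneg (div_nonneg (Real.log_natCast_nonneg M) ?_) (Nat.cast_nonneg n)
    exact_mod_cast Real.log_natCast_nonneg (m + 1)
  refine of_mem_Icc_of_digit hβ (mul_div_sub_one hβ m) ha haL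
    (fun d x h => h.of_digit (by linarith) hm hr) (fun y hy => ?_) hx
  refine hasExpansionRate_of_splits (B := m / (β - 1)) hβ hm hM hn (fun z hz => ?_) hs hy
  rw [abs_of_nonneg (ha.le.trans hz.1)]
  linarith [hz.2]

theorem sq_lt_of_lt_generalisedGoldenRatio {β : ℝ} {k : ℕ} (hβ : 1 < β)
    (h : β < generalisedGoldenRatio (2 * k + 1)) : β ^ 2 < (k + 1) * (β + 1) := by
  have hodd : ¬ Even (2 * k + 1) := by simp
  have hk : (2 * k + 1) / 2 = k := by omega
  rw [generalisedGoldenRatio, if_neg hodd, hk] at h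
  by_contra! hc
  have hk0 : (0 : ℝ) ≤ k := Nat.cast_nonneg k
  have : √((k : ℝ) ^ 2 + 6 * k + 5) ≤ 2 * β - (k + 1) := by
    rw [Real.sqrt_le_iff]
    constructor <;> nlinarith
  linarith

theorem lt_sq_of_generalisedGoldenRatio_lt {β : ℝ} {k : ℕ}
    (h : generalisedGoldenRatio (2 * k + 1) < β) : (k + 1) * (β + 1) < β ^ 2 := by
  have hodd : ¬ Even (2 * k + 1) := by simp
  have hk : (2 * k + 1) / 2 = k := by omega
  rw [generalisedGoldenRatio, if_neg hodd, hk] at h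
  have : √((k : ℝ) ^ 2 + 6 * k + 5) < 2 * β - (k + 1) := by linarith
  have := Real.lt_sq_of_sqrt_lt this
  nlinarith

theorem generalisedGoldenRatio_two_mul (k : ℕ) : generalisedGoldenRatio (2 * k) = k + 1 := by
  have hk : 2 * k / 2 = k := by omega
  rw [generalisedGoldenRatio, if_pos (by simp), hk]

/-- At a = 0 the conditions are strict below G(m): for m = 2k, L > 2 means β < k + 1; for m = 2k +
1, β(L-1) > k + 1 means β² < (k+1)(β+1). The slack is then spent on a small a. -/
theorem exists_margin {β : ℝ} {m : ℕ} (hβ : 1 < β) (hG : β < generalisedGoldenRatio m) :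
    ∃ a > 0, β * a ≤ m / (β - 1) - a ∧ 1 + 2 * a ≤ m / (β - 1) ∧
      (β + 1) * (1 + a) ≤ β * (m / (β - 1)) ∧
      (2 + 2 * a ≤ m / (β - 1) ∨
        ∃ k : ℕ, m = 2 * k + 1 ∧ k + 1 + a ≤ β * (m / (β - 1) - 1 - a)) := by
  have hL := mul_div_sub_one hβ m
  set L : ℝ := m / (β - 1) with hLdef
  have small : ∀ s : ℝ, 0 < s → ∃ a > 0, (β + 1) * a ≤ 1 ∧ 2 * ((β + 1) * a) ≤ s := by
    intro s hs
    refine ⟨min (1 / (β + 1)) (s / (2 * (β + 1))), by positivity, ?_, ?_⟩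
    · calc _ ≤ (β + 1) * (1 / (β + 1)) := by gcongr; exact min_le_left _ _
        _ = 1 := by field_simp
    · calc _ ≤ 2 * ((β + 1) * (s / (2 * (β + 1)))) := by gcongr; exact min_le_right _ _
        _ = s := by field_simp
  rcases Nat.even_or_odd' m with ⟨k, rfl | rfl⟩
  · rw [generalisedGoldenRatio_two_mul] at hG
    have hL2 : 2 < L := by
      rw [hLdef, lt_div_iff₀ (by linarith)]
      push_cast
      linarith
    obtain ⟨a, ha, ha1, has⟩ := small (L - 2) (by linarith)
    have hβa : a < β * a := by nlinarith
    refine ⟨a, ha, by linarith, by linarith, by nlinarith, Or.inl (by linarith)⟩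
  · have hsq := sq_lt_of_lt_generalisedGoldenRatio hβ hG
    push_cast at hL
    have hk0 : (0 : ℝ) ≤ k := Nat.cast_nonneg k
    have hs : 0 < β * (L - 1) - (k + 1) := by
      have : 0 < (β - 1) * (β * (L - 1) - (k + 1)) := by
        have : (β - 1) * L = 2 * k + 1 := by linarith
        have : (β - 1) * (β * (L - 1) - (k + 1)) =
          β * ((β - 1) * L) - β * (β - 1) - (k + 1) * (β - 1) := by ring
        nlinarith
      exact pos_of_mul_pos_right this (by linarith)
    obtain ⟨a, ha, ha1, has⟩ := small _ hs
    have hβa : a < β * a := by nlinarith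
    have hL1 : 1 < L := by nlinarith
    refine ⟨a, ha, by linarith, ?_, by linarith, Or.inr ⟨k, rfl, by linarith⟩⟩
    have : β * (1 + 2 * a) ≤ β * L := by linarith
    exact le_of_mul_le_mul_left this (by linarith)

theorem exists_hasExpansionRate {β : ℝ} {m : ℕ} (hβ : 1 < β) (hm : 1 ≤ m)
    (hG : β < generalisedGoldenRatio m) :
    ∃ r > 0, ∀ x ∈ Ioo (0 : ℝ) (m / (β - 1)), HasExpansionRate β m r x := by
  obtain ⟨a, ha, haL, h1, h3, hgap⟩ := exists_margin hβ hG
  obtain ⟨n, hn, hs⟩ := exists_forall_splits_two hβ (mul_div_sub_one hβ m) ha h1 h3 hgap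
  refine ⟨_, ?_, fun x hx => hasExpansionRate_of_forall_splits hβ hm le_rfl hn ha haL hs hx⟩
  have hm1 : (1 : ℝ) ≤ m := by exact_mod_cast hm
  exact div_pos (Real.logb_pos (by linarith) (by norm_num)) (by exact_mod_cast hn)

theorem exists_hasExpansionRate_of_large {β : ℝ} {m : ℕ} (hβ : 1 < β)
    (hm : 16 * (β + 1) ^ 2 ≤ m) :
    ∃ r ≥ (1 / 2 : ℝ), ∀ x ∈ Ioo (0 : ℝ) (m / (β - 1)), HasExpansionRate β m r x := by
  have hm1 : (1 : ℝ) < m := by nlinarith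
  have hm' : 1 ≤ m := by exact_mod_cast hm1.le
  set t : ℝ := m / (β + 1) with ht
  have htm : t * (β + 1) = m := by rw [ht]; field_simp
  have ht16 : 16 * (β + 1) ≤ t := by
    rw [ht, le_div_iff₀ (by linarith)]
    nlinarith
  have hfl := Nat.floor_le (a := t) (by positivity)
  have hfl' := Nat.sub_one_lt_floor t
  set M := ⌊t⌋₊ with hM
  have hM2 : 2 ≤ M := by
    have : ((2 : ℕ) : ℝ) ≤ M := by push_cast; linarith
    exact_mod_cast this
  have hβ2 : 0 < β ^ 2 - 1 := by nlinarith
  have haL : β * (m / (β ^ 2 - 1)) = m / (β - 1) - m / (β ^ 2 - 1) := by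
    have h1 : β - 1 ≠ 0 := by linarith
    have h2 : β ^ 2 - 1 ≠ 0 := hβ2.ne'
    field_simp
    ring
  have hlen : (M : ℝ) ≤ m / (β - 1) - 2 * (m / (β ^ 2 - 1)) := by
    have h1 : β - 1 ≠ 0 := by linarith
    have h2 : β ^ 2 - 1 ≠ 0 := hβ2.ne'
    have : t = m / (β - 1) - 2 * (m / (β ^ 2 - 1)) := by
      rw [ht]
      field_simp
      ring
    linarith
  -- This a solves βa = L - a, and K then has length t = m/(β+1).
  refine ⟨_, ?_, fun x hx => hasExpansionRate_of_forall_splits hβ hm' hM2 one_pos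
    (a := m / (β ^ 2 - 1)) (by positivity) haL.le
    (fun y hy => splits_of_length hβ (mul_div_sub_one hβ m) haL hlen hy) hx⟩
  -- Here (t/2)² = tm/(4(β+1)) ≥ 4m, by the factor 16 in the hypothesis.
  have hsq : (m : ℝ) + 1 ≤ (M : ℝ) ^ 2 := by
    have h1 : t / 2 ≤ M := by linarith
    have h2 : (t / 2) ^ 2 ≤ (M : ℝ) ^ 2 := by gcongr
    nlinarith
  have hlog : Real.logb ((m : ℝ) + 1) ((m : ℝ) + 1) ≤ Real.logb ((m : ℝ) + 1) ((M : ℝ) ^ 2) :=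
    Real.logb_le_logb_of_le (by linarith) (by linarith) hsq
  rw [Real.logb_self_eq_one (by linarith), Real.logb_pow] at hlog
  push_cast at hlog ⊢
  linarith

theorem betaExpansions_not_countable {β : ℝ} {m : ℕ} (hβ : 1 < β) (hm : 1 ≤ m)
    (hG : β < generalisedGoldenRatio m) {x : ℝ} (hx : x ∈ Ioo (0 : ℝ) (m / (β - 1))) :
    ¬ (betaExpansions β m x).Countable := by
  obtain ⟨r, hr, h⟩ := exists_hasExpansionRate hβ hm hG
  intro hc
  have := (h x hx).1
  rw [dimH_countable hc] at this
  simp at this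
  linarith

/-! ### Unique expansions above the threshold. -/

theorem mem_Icc_of_mem_betaExpansions {β x : ℝ} {m : ℕ} (hβ : 1 < β) {ε : DigitSeq m}
    (h : ε ∈ betaExpansions β m x) : x ∈ Icc (0 : ℝ) (m / (β - 1)) := by
  change HasSum _ _ at h
  have hβ0 : 0 < β := by linarith
  refine ⟨h.nonneg fun i => by positivity, ?_⟩
  have hg := ((hasSum_geometric_of_lt_one (r := β⁻¹) (by positivity)
    (inv_lt_one_of_one_lt₀ hβ)).mul_left (m * β⁻¹ : ℝ))
  refine (hasSum_le (fun i => ?_) h hg).trans (le_of_eq ?_)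
  · have : ((ε i : ℕ) : ℝ) ≤ m := by exact_mod_cast Nat.lt_succ_iff.mp (ε i).2
    calc ((ε i : ℕ) : ℝ) / β ^ (i + 1) ≤ m / β ^ (i + 1) := by gcongr
      _ = m * β⁻¹ * β⁻¹ ^ i := by
        rw [inv_pow, pow_succ]
        field_simp
  · have : β - 1 ≠ 0 := by linarith
    field_simp

/-- If every point of `S` has exactly one digit that does not lead out of `[0, m / (β - 1)]`, and
this digit leads back to `S`, then the points of `S` have unique expansions. -/
theorem encard_betaExpansions_eq_one {β : ℝ} {m : ℕ} (hβ : 1 < β) {S : Set ℝ}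
    (hS : ∀ y ∈ S, ∃ d : Fin (m + 1), β * y - (d : ℕ) ∈ S ∧
      ∀ d' : Fin (m + 1), β * y - (d' : ℕ) ∈ Icc (0 : ℝ) (m / (β - 1)) → d' = d)
    {B : ℝ} (hB : ∀ y ∈ S, |y| ≤ B) {x : ℝ} (hx : x ∈ S) :
    (betaExpansions β m x).encard = 1 := by
  have hβ0 : β ≠ 0 := by linarith
  have hne : (betaExpansions β m x).Nonempty := by
    have : ∃ W : ℝ → Fin 1 → Fin 1 → Fin (m + 1), ∀ y ∈ S, ∀ c, wordMap β (W y c) y ∈ S := by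
      classical
      refine ⟨fun y _ _ => if h : y ∈ S then (hS y h).choose else 0, fun y hy c => ?_⟩
      rw [wordMap_one hβ0]
      simpa [hy] using (hS y hy).choose_spec.1
    obtain ⟨W, hW⟩ := this
    exact ⟨_, blockSeq_mem_betaExpansions β W x hβ one_pos hB hW hx fun _ => 0⟩
  have huniq : ∀ (i : ℕ) (y : ℝ), y ∈ S → ∀ ε ∈ betaExpansions β m y,
      ∀ δ ∈ betaExpansions β m y, ε i = δ i := by
    have hhead : ∀ y ∈ S, ∀ ε ∈ betaExpansions β m y, ∀ δ ∈ betaExpansions β m y,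
        ε 0 = δ 0 ∧ β * y - (ε 0 : ℕ) ∈ S := by
      intro y hy ε hε δ hδ
      obtain ⟨d, hd, hd'⟩ := hS y hy
      have h1 := hd' _ (mem_Icc_of_mem_betaExpansions hβ (tail_mem_betaExpansions hβ0 hε))
      have h2 := hd' _ (mem_Icc_of_mem_betaExpansions hβ (tail_mem_betaExpansions hβ0 hδ))
      exact ⟨h1.trans h2.symm, by rw [h1]; exact hd⟩
    intro i
    induction i with
    | zero => exact fun y hy ε hε δ hδ => (hhead y hy ε hε δ hδ).1
    | succ i ih =>
      intro y hy ε hε δ hδ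
      obtain ⟨h0, hmem⟩ := hhead y hy ε hε δ hδ
      have h2 := tail_mem_betaExpansions hβ0 hδ
      rw [← h0] at h2
      exact ih _ hmem _ (tail_mem_betaExpansions hβ0 hε) _ h2
  obtain ⟨ε, hε⟩ := hne
  exact encard_eq_one.mpr ⟨ε, eq_singleton_iff_unique_mem.mpr
    ⟨hε, fun δ hδ => funext fun i => huniq i x hx δ hδ ε hε⟩⟩

/-- A larger digit sends the point below 0, a smaller one above L. -/
theorem digit_eq_of_mem_Icc {L y w : ℝ} {m : ℕ} {d d' : Fin (m + 1)} (hy : y - (d : ℕ) = w)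
    (hw : w < 1) (hw' : L < w + 1) (h : y - (d' : ℕ) ∈ Icc 0 L) : d' = d := by
  rcases lt_trichotomy (d' : ℕ) d with hlt | heq | hgt
  · have : ((d' : ℕ) : ℝ) + 1 ≤ (d : ℕ) := by exact_mod_cast hlt
    linarith [h.2]
  · exact Fin.ext heq
  · have : ((d : ℕ) : ℝ) + 1 ≤ (d' : ℕ) := by exact_mod_cast hgt
    linarith [h.1]

theorem exists_unique_expansion {β : ℝ} {m : ℕ} (hβ : 1 < β) (hm : 1 ≤ m)
    (hG : generalisedGoldenRatio m < β) :
    ∃ x ∈ Ioo (0 : ℝ) (m / (β - 1)), (betaExpansions β m x).encard = 1 := by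
  have hβ1 : 0 < β - 1 := by linarith
  rcases Nat.even_or_odd' m with ⟨k, rfl | rfl⟩
  · rw [generalisedGoldenRatio_two_mul] at hG
    have hk : (0 : ℝ) < k := by exact_mod_cast (by omega : 0 < k)
    have hx0 : 0 < k / (β - 1) := by positivity
    have hx1 : k / (β - 1) < 1 := by rw [div_lt_one hβ1]; linarith
    have hfix := mul_div_sub_one hβ k
    have hL : ((2 * k : ℕ) : ℝ) / (β - 1) = 2 * (k / (β - 1)) := by push_cast; ring
    refine ⟨k / (β - 1), ⟨hx0, by linarith⟩,
      encard_betaExpansions_eq_one (S := {k / (β - 1)}) (B := 1) hβ ?_ ?_ rfl⟩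
    · rintro y rfl
      have hd : β * (k / (β - 1)) - ((⟨k, by omega⟩ : Fin (2 * k + 1)) : ℕ) = k / (β - 1) := by
        simp only
        linarith
      exact ⟨⟨k, by omega⟩, hd, fun d' h => digit_eq_of_mem_Icc hd hx1 (by linarith) h⟩
    · rintro y rfl
      rw [abs_of_pos hx0]
      exact hx1.le
  · have hsq := lt_sq_of_generalisedGoldenRatio_lt hG
    have hk : (0 : ℝ) ≤ k := Nat.cast_nonneg k
    have hβ2 : 0 < β ^ 2 - 1 := by nlinarith
    -- The 2-cycle p ↦ q ↦ p under digits k and k + 1. It satisfies p + q = L, and q < 1 is exactly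
    -- (k+1)(β+1) < β².
    set p : ℝ := (k * β + (k + 1)) / (β ^ 2 - 1) with hp
    set q : ℝ := ((k + 1) * β + k) / (β ^ 2 - 1) with hq
    have hp0 : 0 < p := by positivity
    have hq0 : 0 < q := by positivity
    have hq1 : q < 1 := by rw [hq, div_lt_one hβ2]; linarith
    have hpq : p ≤ q := by
      rw [hp, hq]
      gcongr ?_ / _
      linarith
    have hβne : β ^ 2 - 1 ≠ 0 := hβ2.ne'
    have hβne' : β - 1 ≠ 0 := hβ1.ne'
    have hpk : β * p - k = q := by
      rw [hp, hq]
      field_simp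
      ring
    have hqk : β * q - (k + 1) = p := by
      rw [hp, hq]
      field_simp
      ring
    have hL : ((2 * k + 1 : ℕ) : ℝ) / (β - 1) = p + q := by
      rw [hp, hq]
      push_cast
      field_simp
      ring
    refine ⟨p, ⟨hp0, by linarith⟩,
      encard_betaExpansions_eq_one (S := {p, q}) (B := 1) hβ ?_ ?_ (by simp)⟩
    · rintro y (rfl | rfl)
      · have hd : β * p - ((⟨k, by omega⟩ : Fin (2 * k + 1 + 1)) : ℕ) = q := hpk
        exact ⟨⟨k, by omega⟩, by rw [hd]; simp,
          fun d' h => digit_eq_of_mem_Icc hd hq1 (by linarith) h⟩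
      · have hd : β * q - ((⟨k + 1, by omega⟩ : Fin (2 * k + 1 + 1)) : ℕ) = p := by
          simpa using hqk
        exact ⟨⟨k + 1, by omega⟩, by rw [hd]; simp,
          fun d' h => digit_eq_of_mem_Icc hd (by linarith) (by linarith) h⟩
    · rintro y (rfl | rfl)
      · rw [abs_of_pos hp0]
        linarith
      · rw [abs_of_pos hq0]
        linarith

/-! ### Uniformity in m, and the theorem. -/

theorem exists_uniform_hasExpansionRate {β : ℝ} (hβ : 1 < β) :
    ∃ c > 0, ∀ m : ℕ, 1 ≤ m → β < generalisedGoldenRatio m →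
      ∃ r ≥ c, ∀ x ∈ Ioo (0 : ℝ) (m / (β - 1)), HasExpansionRate β m r x := by
  -- A minimum over the finitely many m below N.
  have hfin : ∀ N : ℕ, ∃ c > 0, ∀ m < N, 1 ≤ m → β < generalisedGoldenRatio m →
      ∃ r ≥ c, ∀ x ∈ Ioo (0 : ℝ) (m / (β - 1)), HasExpansionRate β m r x := by
    intro N
    induction N with
    | zero => exact ⟨1, one_pos, fun m hm => absurd hm (Nat.not_lt_zero m)⟩
    | succ N ih =>
      obtain ⟨c, hc, h⟩ := ih
      by_cases hN : 1 ≤ N ∧ β < generalisedGoldenRatio N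
      · obtain ⟨r, hr, hrx⟩ := exists_hasExpansionRate hβ hN.1 hN.2
        refine ⟨min c r, lt_min hc hr, fun m hm h1 h2 => ?_⟩
        rcases Nat.lt_succ_iff_lt_or_eq.mp hm with hlt | rfl
        · obtain ⟨s, hs, hsx⟩ := h m hlt h1 h2
          exact ⟨s, (min_le_left _ _).trans hs, hsx⟩
        · exact ⟨r, min_le_right _ _, hrx⟩
      · refine ⟨c, hc, fun m hm h1 h2 => ?_⟩
        rcases Nat.lt_succ_iff_lt_or_eq.mp hm with hlt | rfl
        · exact h m hlt h1 h2
        · exact absurd ⟨h1, h2⟩ hN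
  obtain ⟨c, hc, h⟩ := hfin ⌈16 * (β + 1) ^ 2⌉₊
  refine ⟨min c (1 / 2), by positivity, fun m h1 h2 => ?_⟩
  rcases lt_or_ge m ⌈16 * (β + 1) ^ 2⌉₊ with hlt | hge
  · obtain ⟨s, hs, hsx⟩ := h m hlt h1 h2
    exact ⟨s, (min_le_left _ _).trans hs, hsx⟩
  · obtain ⟨s, hs, hsx⟩ := exists_hasExpansionRate_of_large (m := m) hβ (Nat.ceil_le.mp hge)
    exact ⟨s, (min_le_right _ _).trans hs, hsx⟩

theorem mainTheorem2 :
    (∀ m : ℕ, 1 ≤ m → IsGeneralisedGoldenRatio m (generalisedGoldenRatio m)) ∧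
    (∀ β : ℝ, 1 < β → ∃ c : ℝ, 0 < c ∧
      ∀ m : ℕ, 1 ≤ m → β < generalisedGoldenRatio m →
        ∀ x : ℝ, x ∈ Set.Ioo (0 : ℝ) (m / (β - 1)) →
          ENNReal.ofReal c ≤ dimH (betaExpansions β m x) ∧
          c ≤ lowerGrowthRate β m x ∧
          c ≤ upperGrowthRate β m x) := by
  refine ⟨fun m hm => ⟨fun β hβ hG x hx => betaExpansions_not_countable hβ hm hG hx,
    fun β hβ hG _ => exists_unique_expansion hβ hm hG⟩, fun β hβ => ?_⟩
  obtain ⟨c, hc, h⟩ := exists_uniform_hasExpansionRate hβ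
  refine ⟨c / 2, by positivity, fun m hm hG x hx => ?_⟩
  obtain ⟨r, hr, hrx⟩ := h m hm hG
  obtain ⟨h1, h2, h3⟩ := (hrx x hx).growth hm (by linarith)
  exact ⟨(ENNReal.ofReal_le_ofReal (by linarith)).trans h1, by linarith, by linarith⟩
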